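/- **Theorem (Existence of an infinite-horizon Berk–Nash solution).** Let $X$ and $A$ be nonempty finite sets (states and actions), $P(\cdot\mid x,a)\in\Delta(X)$ for $(x,a)\in X\times A$ the true transition kernel, $r:X\times A\to\mathbb R$ a reward function, $\beta\in(0,1)$, $\Theta\subset\mathbb R^k$ a nonempty compact convex set, and $Q_\theta(\cdot\mid x,a)\in\Delta(X)$, $\theta\in\Theta$, a family of subjective transition kernels such that $\theta\mapsto Q_\theta(x'\mid x,a)$ is continuous on $\Theta$ for all $x,a,x'$. Let $\Sigma=\Delta(A)^X$ be the set of stationary randomized policies, with the product topology. For $\pi\in\Sigma$ and $\theta\in\Theta$ let $$V_\theta^\pi(x)=\mathbb E^{\pi}_{Q_\theta}\Big[\sum_{t=0}^\infty\beta^t r(x_t,a_t)\,\Big|\,x_0=x\Big],\qquad V_\theta(x)=\sup_{\pi\in\Sigma}V_\theta^\pi(x),$$ where $a_t\sim\pi(\cdot\mid x_t)$ and $x_{t+1}\sim Q_\theta(\cdot\mid x_t,a_t)$, and let $BR(\theta)$ be the set of all $\pi\in\Sigma$ such that, for all $x$ and $a$, $$\pi(a\mid x)>0\ \Rightarrow\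 a\in\arg\max_{b\in A}\Big\{r(x,b)+\beta\sum_{x'}Q_\theta(x'\mid x,b)V_\theta(x')\Big\}.$$ Assume that for every $\pi\in\Sigma$ the Markov chain on $X$ with transition probabilities $P_\pi(x'\mid x)=\sum_a\pi(a\mid x)P(x'\mid x,a)$ is irreducible and aperiodic, let $\mu_\pi$ be its unique stationary distribution, and assume that $\pi\mapsto\mu_\pi$ is continuous from $\Sigma$ to $\Delta(X)$. Assume further that $P(\cdot\mid x,a)\ll Q_\theta(\cdot\mid x,a)$ for all $x,a$ and all $\theta\in\Theta$, and that the long-run Kullback–Leibler divergence $$D(\theta\mid\pi)=\sum_{x}\sum_{a}\mu_\pi(x)\,\pi(a\mid x)\sum_{x'}P(x'\mid x,a)\log\frac{P(x'\mid x,a)}{Q_\theta(x'\mid x,a)}$$ (which is then finite; terms with $P(x'\mid x,a)=0$ are $0$) is jointly continuous in $(\theta,\pi)\in\Theta\times\Sigma$ and convex in $\theta$ for each fixed $\pi$. Let $\Theta^\ast(\pi)=\arg\min_{\theta\in\Theta}D(\theta\mid\pi)$. Then there exists a pair $(\pi^\ast,\theta^\ast)\in\Sigma\times\Theta$ with $$\pi^\ast\in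 BR(\theta^\ast)\quad\text{and}\quad\theta^\ast\in\Theta^\ast(\pi^\ast).$$ -/

import Mathlib

open MeasureTheory ProbabilityTheory

noncomputable section

namespace BerkNash

variable {X A : Type*} [Fintype X] [Fintype A]

/-- Stationary randomized policies `Σ = Δ(A)^X`, with the product topology;
`π x a` is the probability `π(a ∣ x)`. -/
abbrev Policy (X A : Type*) [Fintype A] := X → stdSimplex ℝ A

/-- Controlled transition kernels; `K x a x'` is the probability `K(x' ∣ x, a)`. -/
abbrev TransitionKernel (X A : Type*) [Fintype X] := X → A → stdSimplex ℝ X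

/-! ### The controlled process and its discounted value -/

/-- A state together with the action taken in it, with the discrete σ-algebra. -/
structure StateAction (X A : Type*) where
  /-- the state `x_t` -/
  state : X
  /-- the action `a_t` -/
  action : A

/-- Every set of state-action pairs is measurable. -/
instance (X A : Type*) : MeasurableSpace (StateAction X A) := ⊤

instance (X A : Type*) : DiscreteMeasurableSpace (StateAction X A) := ⟨fun _ => trivial⟩

/-- The probability measure on state-action pairs under which the state has distribution `ν` and,
given the state `x`, the action has distribution `π(· ∣ x)`. -/
def pairMeasure (π : Policy X A) (ν : stdSimplex ℝ X) : Measure (StateAction X A) :=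
  ∑ x, ∑ a, ENNReal.ofReal (ν x * π x a) • Measure.dirac (StateAction.mk x a)

instance (π : Policy X A) (ν : stdSimplex ℝ X) : IsProbabilityMeasure (pairMeasure π ν) where
  measure_univ := by
    have h0 : ∀ x a, 0 ≤ ν x * π x a := fun x a => mul_nonneg (ν.2.1 x) ((π x).2.1 a)
    have h1 : ∀ x, ∑ a, π x a = 1 := fun x => (π x).2.2
    have h2 : ∑ x, ν x = 1 := ν.2.2
    simp only [pairMeasure, Measure.coe_finsetSum, Finset.sum_apply, Measure.smul_apply,
      measure_univ, smul_eq_mul, mul_one]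
    simp_rw [← ENNReal.ofReal_sum_of_nonneg (fun a _ => h0 _ a)]
    rw [← ENNReal.ofReal_sum_of_nonneg
      (fun x _ => Finset.sum_nonneg fun a _ => h0 x a)]
    simp_rw [← Finset.mul_sum, h1, mul_one, h2, ENNReal.ofReal_one]

/-- The law of `(x_{t+1}, a_{t+1})` given the history up to time `t`:
`x_{t+1} ∼ K(· ∣ x_t, a_t)` and `a_{t+1} ∼ π(· ∣ x_{t+1})`. -/
def stepKernel (K : TransitionKernel X A) (π : Policy X A) (t : ℕ) :
    Kernel (Π _ : Finset.Iic t, StateAction X A) (StateAction X A) where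
  toFun h :=
    pairMeasure π (K (h ⟨t, Finset.mem_Iic.2 le_rfl⟩).state (h ⟨t, Finset.mem_Iic.2 le_rfl⟩).action)
  measurable' :=
    (Measurable.of_discrete
      (f := fun s : StateAction X A => pairMeasure π (K s.state s.action))).comp
      (measurable_pi_apply _)

instance (K : TransitionKernel X A) (π : Policy X A) (t : ℕ) :
    IsMarkovKernel (stepKernel K π t) :=
  ⟨fun _ => inferInstanceAs (IsProbabilityMeasure (pairMeasure π _))⟩

/-- The law of `(x_0, a_0)` when `x_0 = x` and `a_0 ∼ π(· ∣ x)`. -/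
def initialMeasure (π : Policy X A) (x : X) : Measure (StateAction X A) :=
  ∑ a, ENNReal.ofReal (π x a) • Measure.dirac (StateAction.mk x a)

instance (π : Policy X A) (x : X) : IsProbabilityMeasure (initialMeasure π x) where
  measure_univ := by
    have h0 : ∀ a, 0 ≤ π x a := (π x).2.1
    have h1 : ∑ a, π x a = 1 := (π x).2.2
    simp only [initialMeasure, Measure.coe_finsetSum, Finset.sum_apply, Measure.smul_apply,
      measure_univ, smul_eq_mul, mul_one]
    rw [← ENNReal.ofReal_sum_of_nonneg (fun a _ => h0 a), h1, ENNReal.ofReal_one]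

/-- The law, on the space of all trajectories `((x_0, a_0), (x_1, a_1), …)`, of the process
controlled by the policy `π`, with transition kernel `K` and initial state `x`. -/
def processLaw (K : TransitionKernel X A) (π : Policy X A) (x : X) :
    Measure (ℕ → StateAction X A) :=
  Kernel.trajMeasure (X := fun _ => StateAction X A) (initialMeasure π x) (stepKernel K π)

/-- The discounted value `E[∑_t β^t r(x_t, a_t) ∣ x_0 = x]` of the policy `π` under the
transition kernel `K`. -/
def value (K : TransitionKernel X A) (r : X → A → ℝ) (β : ℝ) (π : Policy X A) (x : X) : ℝ :=
  ∫ ω, ∑' t : ℕ, β ^ t * r (ω t).state (ω t).action ∂(processLaw K π x)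

/-- The optimal value `V(x) = sup_π V^π(x)` under the transition kernel `K`. -/
def optimalValue (K : TransitionKernel X A) (r : X → A → ℝ) (β : ℝ) (x : X) : ℝ :=
  ⨆ π : Policy X A, value K r β π x

/-! ### Subjective optimality -/

/-- `r(x, a) + β ∑_{x'} K(x' ∣ x, a) V(x')`, with `V` the optimal value function. -/
def actionValue (K : TransitionKernel X A) (r : X → A → ℝ) (β : ℝ) (x : X) (a : A) : ℝ :=
  r x a + β * ∑ x', K x a x' * optimalValue K r β x'

/-- The best-response correspondence `BR(θ)` of the subjective models `Q_θ`: policies that put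
positive probability only on actions that maximize the action value. -/
def bestResponse {T : Type*} (Q : T → TransitionKernel X A) (r : X → A → ℝ) (β : ℝ) (θ : T) :
    Set (Policy X A) :=
  {π | ∀ x a, 0 < π x a → ∀ b, actionValue (Q θ) r β x b ≤ actionValue (Q θ) r β x a}

/-! ### Long-run statistical consistency -/

/-- The Markov transition matrix `P_π(x' ∣ x) = ∑_a π(a ∣ x) P(x' ∣ x, a)`
(row `x`, column `x'`). -/
def inducedMatrix (P : TransitionKernel X A) (π : Policy X A) : Matrix X X ℝ :=
  Matrix.of fun x x' => ∑ a, π x a * P x a x'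

/-- Every state of the Markov chain has period one: `1` is the only common divisor of the
possible return times `n ≥ 1`. -/
def IsAperiodic [DecidableEq X] (M : Matrix X X ℝ) : Prop :=
  ∀ x, ∀ d : ℕ, (∀ n : ℕ, 1 ≤ n → 0 < (M ^ n) x x → d ∣ n) → d = 1

/-- `μ` is a stationary distribution of the true process under `π`. -/
def IsStationary (P : TransitionKernel X A) (π : Policy X A) (μ : stdSimplex ℝ X) : Prop :=
  ∀ x', μ x' = ∑ x, ∑ a, μ x * π x a * P x a x'

/-- The stationary distribution `μ_π`. It is meaningful as soon as `inducedMatrix P π` is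
irreducible, since there is then exactly one stationary distribution. -/
def stationaryDist [Nonempty X] (P : TransitionKernel X A) (π : Policy X A) : stdSimplex ℝ X :=
  Classical.epsilon (IsStationary P π)

/-- The Kullback-Leibler divergence of `ν` from `μ`, for `ν ≪ μ`
(terms with `ν x' = 0` vanish). -/
def klDivergence (ν μ : stdSimplex ℝ X) : ℝ :=
  ∑ x', ν x' * Real.log (ν x' / μ x')

/-- The long-run Kullback-Leibler divergence `D(θ ∣ π)`. -/
def longRunKL [Nonempty X] {T : Type*} (P : TransitionKernel X A) (Q : T → TransitionKernel X A)
    (θ : T) (π : Policy X A) : ℝ :=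
  ∑ x, ∑ a, stationaryDist P π x * π x a * klDivergence (P x a) (Q θ x a)

/-- The pseudo-true parameters `Θ^*(π) = argmin_{θ ∈ Θ} D(θ ∣ π)`. -/
def pseudoTrue [Nonempty X] {T : Type*} (P : TransitionKernel X A) (Q : T → TransitionKernel X A)
    (Θ : Set T) (π : Policy X A) : Set T :=
  {θ | θ ∈ Θ ∧ ∀ θ' ∈ Θ, longRunKL P Q θ π ≤ longRunKL P Q θ' π}

/-- Infinite-horizon Berk-Nash solutions: `π ∈ BR(θ)` and `θ ∈ Θ^*(π)`. -/
structure IsSolution [Nonempty X] {T : Type*} (P : TransitionKernel X A)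
    (Q : T → TransitionKernel X A) (Θ : Set T) (r : X → A → ℝ) (β : ℝ)
    (π : Policy X A) (θ : T) : Prop where
  subjective_optimality : π ∈ bestResponse Q r β θ
  statistical_consistency : θ ∈ pseudoTrue P Q Θ π

end BerkNash

end

/-!
Each expected reward `E[r (x_t, a_t)]` is a polynomial in the transition probabilities and the
policy, and the discounted series converges uniformly, so the value is jointly continuous in the
kernel and the policy. The supremum over the compact space of policies is then continuous in the
kernel, and so are the action values. A solution is therefore an equilibrium of a game with
continuous and concave payoffs: the agent picks a policy to maximize the sum of its expected
action values under `θ`, which is linear in the policy, while nature picks `θ` to minimize the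
convex function `D (θ ∣ π)`. Such a game has an equilibrium by Ky Fan's inequality, which follows
from the Knaster-Kuratowski-Mazurkiewicz lemma, and the latter from Scarf's parity argument on
dominant sets of points of the simplex.
-/

/-! ### Scarf's lemma on dominant sets -/

namespace Scarf

open Finset

section Dominant

variable {ι V α : Type*} [LinearOrder α] {u : ι → V → α} {S T : Finset V} {m : ι → V} {k : ι}

/-- Dominant sets in the sense of Scarf (primitive sets): with respect to the rankings
`u i : V → α`, no element of `V` ranks strictly above all the minima of `S`. -/
def IsDominant (u : ι → V → α) (S : Finset V) : Prop :=
  ∀ y, ∃ i, ∀ x ∈ S, u i y ≤ u i x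

theorem IsDominant.mono (hT : IsDominant u T) (h : S ⊆ T) : IsDominant u S := fun y =>
  (hT y).imp fun _ hi x hx => hi x (h hx)

/-- A choice of a lowest element of `S` in each of the rankings. -/
structure IsLowest (u : ι → V → α) (S : Finset V) (m : ι → V) : Prop where
  mem : ∀ i, m i ∈ S
  le : ∀ i, ∀ x ∈ S, u i (m i) ≤ u i x

theorem exists_isLowest (u : ι → V → α) (hS : S.Nonempty) : ∃ m, IsLowest u S m := by
  choose m hm hle using fun i => S.exists_min_image (u i) hS
  exact ⟨m, hm, hle⟩

/-- The elements that beat the thresholds `m l` in every ranking `l ≠ k`. -/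
def above (u : ι → V → α) (m : ι → V) (k : ι) : Set V :=
  {y | ∀ l ≠ k, u l (m l) < u l y}

/-- The highest elements of `above u m k` in the ranking `k`. When `m` is a choice of lowest
elements of `S`, these are the candidates for replacing `m k` in `S`. -/
def peaks (u : ι → V → α) (m : ι → V) (k : ι) : Set V :=
  {x ∈ above u m k | ∀ y ∈ above u m k, u k y ≤ u k x}

theorem nonempty_peaks [Finite V] (h : (above u m k).Nonempty) : (peaks u m k).Nonempty :=
  Set.exists_max_image _ (u k) (Set.toFinite _) h

theorem subsingleton_peaks (hu : Function.Injective (u k)) : (peaks u m k).Subsingleton :=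
  fun x hx y hy => hu ((hy.2 x hx.1).antisymm (hx.2 y hy.1))

theorem IsDominant.exists_le (hS : IsDominant u S) (hm : IsLowest u S m) (y : V) :
    ∃ i, u i y ≤ u i (m i) :=
  (hS y).imp fun i hi => hi _ (hm.mem i)

theorem IsDominant.le_of_mem_above (hS : IsDominant u S) (hm : IsLowest u S m) {y : V}
    (hy : y ∈ above u m k) : u k y ≤ u k (m k) := by
  obtain ⟨l, hl⟩ := hS.exists_le hm y
  obtain rfl : l = k := by_contra fun hlk => (hy l hlk).not_ge hl
  exact hl

theorem IsDominant.disjoint_peaks (hS : IsDominant u S) (hm : IsLowest u S m) {j : ι}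
    (hkj : k ≠ j) : Disjoint (peaks u m k) (peaks u m j) :=
  Set.disjoint_left.2 fun _ hk hj => (hj.1 k hkj).not_ge (hS.le_of_mem_above hm hk.1)

theorem IsDominant.exists_lowest_eq (hu : ∀ i, Function.Injective (u i)) (hS : IsDominant u S)
    (hm : IsLowest u S m) {x : V} (hx : x ∈ S) : ∃ i, m i = x := by
  obtain ⟨i, hi⟩ := hS.exists_le hm x
  exact ⟨i, hu i ((hm.le i x hx).antisymm hi)⟩

theorem IsDominant.notMem_of_mem_peaks (hu : ∀ i, Function.Injective (u i)) (hS : IsDominant u S)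
    (hm : IsLowest u S m) {j : ι} (hkj : k ≠ j) (hmkj : m k = m j) {x : V}
    (hx : x ∈ peaks u m k) : x ∉ S := by
  intro hxS
  obtain ⟨l, rfl⟩ := hS.exists_lowest_eq hu hm hxS
  by_cases hlk : l = k
  · exact (hx.1 j hkj.symm).ne (by rw [hlk, hmkj])
  · exact (hx.1 l hlk).ne rfl

section Fintype

variable [Fintype ι]

theorem IsDominant.lowest_injective (hu : ∀ i, Function.Injective (u i)) (hS : IsDominant u S)
    (hm : IsLowest u S m) (hcard : #S = Fintype.card ι) : Function.Injective m := by
  classical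
  have himage : univ.image m = S :=
    subset_antisymm (image_subset_iff.2 fun i _ => hm.mem i) fun x hx => by
      simpa using hS.exists_lowest_eq hu hm hx
  rw [← Set.injOn_univ, ← coe_univ, ← card_image_iff, himage, hcard, card_univ]

theorem IsLowest.exists_ne_map_eq (hm : IsLowest u S m) (hcard : #S + 1 = Fintype.card ι) :
    ∃ i j, i ≠ j ∧ m i = m j := by
  have hlt : #S < #(univ : Finset ι) := by rw [card_univ]; omega
  obtain ⟨i, -, j, -, hij, hmij⟩ :=
    exists_ne_map_eq_of_card_lt_of_maps_to hlt fun i _ => hm.mem i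
  exact ⟨i, j, hij, hmij⟩

end Fintype

variable [DecidableEq V]

theorem IsDominant.insert_of_mem_peaks (hS : IsDominant u S) (hm : IsLowest u S m) {x : V}
    (hx : x ∈ peaks u m k) : IsDominant u (insert x S) := by
  intro y
  simp only [forall_mem_insert]
  by_cases hy : y ∈ above u m k
  · exact ⟨k, hx.2 y hy, fun z hz =>
      ((hx.2 y hy).trans (hS.le_of_mem_above hm hx.1)).trans (hm.le k z hz)⟩
  · obtain ⟨l, hlk, hl⟩ : ∃ l ≠ k, u l y ≤ u l (m l) := by simpa [above] using hy
    exact ⟨l, hl.trans (hx.1 l hlk).le, fun z hz => hl.trans (hm.le l z hz)⟩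

open Classical in
/-- The elements whose insertion into `S` keeps it dominant. -/
noncomputable def extensions [Fintype V] (u : ι → V → α) (S : Finset V) : Finset V :=
  {x | x ∉ S ∧ IsDominant u (insert x S)}

theorem mem_extensions [Fintype V] {x : V} :
    x ∈ extensions u S ↔ x ∉ S ∧ IsDominant u (insert x S) := by
  simp [extensions]

variable [Fintype ι]

/-- The new element is the minimum of `insert x S` in one ranking `k`, and the other minima do not
change; as `insert x S` has distinct minima, `k` is `i` or `j`. -/
theorem mem_peaks_of_insert (hu : ∀ i, Function.Injective (u i))
    (hm : IsLowest u S m) (hcard : #S + 1 = Fintype.card ι) {i j : ι} (hij : i ≠ j)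
    (hmij : m i = m j) {x : V} (hxS : x ∉ S) (hx : IsDominant u (insert x S)) :
    x ∈ peaks u m i ∪ peaks u m j := by
  obtain ⟨m', hm'⟩ := exists_isLowest u (insert_nonempty x S)
  have hinj : Function.Injective m' :=
    hx.lowest_injective hu hm' (by rw [card_insert_of_notMem hxS, hcard])
  obtain ⟨k, hk⟩ := hx.exists_lowest_eq hu hm' (mem_insert_self x S)
  have hne : ∀ l ≠ k, m' l ≠ x := fun l hl h => hl (hinj (h.trans hk.symm))
  have heq : ∀ l ≠ k, m' l = m l := fun l hl => hu l <|
    (hm'.le l _ (mem_insert_of_mem (hm.mem l))).antisymm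
      (hm.le l _ (mem_of_mem_insert_of_ne (hm'.mem l) (hne l hl)))
  have habove : x ∈ above u m k := fun l hl => by
    rw [← heq l hl]
    exact (hm'.le l x (mem_insert_self x S)).lt_of_ne ((hu l).ne (hne l hl))
  have hpeak : x ∈ peaks u m k := by
    refine ⟨habove, fun y hy => ?_⟩
    obtain ⟨l, hl⟩ := hx.exists_le hm' y
    obtain rfl : l = k := by_contra fun hlk => (hy l hlk).not_ge (heq l hlk ▸ hl)
    rwa [hk] at hl
  have hkij : k = i ∨ k = j := by
    by_contra! h
    exact hij (hinj (by rw [heq i h.1.symm, heq j h.2.symm, hmij]))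
  rcases hkij with rfl | rfl
  exacts [Or.inl hpeak, Or.inr hpeak]

theorem IsDominant.card_extensions [Fintype V] (hu : ∀ i, Function.Injective (u i))
    (hS : IsDominant u S) (hne : S.Nonempty) (hcard : #S + 1 = Fintype.card ι)
    (habove : ∀ k, ∃ y, ∀ l ≠ k, ∃ x ∈ S, u l x < u l y) : #(extensions u S) = 2 := by
  classical
  obtain ⟨m, hm⟩ := exists_isLowest u hne
  obtain ⟨i, j, hij, hmij⟩ := hm.exists_ne_map_eq hcard
  have hpeak : ∀ k, (peaks u m k).Nonempty := fun k => by
    obtain ⟨y, hy⟩ := habove k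
    refine nonempty_peaks ⟨y, fun l hl => ?_⟩
    obtain ⟨x, hx, hxy⟩ := hy l hl
    exact (hm.le l x hx).trans_lt hxy
  obtain ⟨x, hx⟩ := hpeak i
  obtain ⟨y, hy⟩ := hpeak j
  have hxy : x ≠ y := fun h => Set.disjoint_left.1 (hS.disjoint_peaks hm hij) hx (h ▸ hy)
  refine card_eq_two.2 ⟨x, y, hxy, ext fun z => ?_⟩
  simp only [mem_extensions, mem_insert, mem_singleton]
  constructor
  · rintro ⟨hzS, hz⟩
    exact (mem_peaks_of_insert hu hm hcard hij hmij hzS hz).imp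
      (fun hzi => subsingleton_peaks (hu i) hzi hx) fun hzj => subsingleton_peaks (hu j) hzj hy
  · rintro (rfl | rfl)
    · exact ⟨hS.notMem_of_mem_peaks hu hm hij hmij hx, hS.insert_of_mem_peaks hm hx⟩
    · exact ⟨hS.notMem_of_mem_peaks hu hm hij.symm hmij.symm hy, hS.insert_of_mem_peaks hm hy⟩

end Dominant

section Color

variable {ι V : Type*} [DecidableEq ι] [DecidableEq V] {c : V → ι} {T : Finset V}

theorem image_erase_eq_image {s t : V} (ht : t ∈ T) (hts : t ≠ s) (h : c t = c s) :
    (T.erase s).image c = T.image c := by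
  refine subset_antisymm (image_subset_image (erase_subset _ _)) (image_subset_iff.2 fun v hv => ?_)
  obtain rfl | hvs := eq_or_ne v s
  · exact mem_image.2 ⟨t, mem_erase.2 ⟨hts, ht⟩, h⟩
  · exact mem_image_of_mem c (mem_erase.2 ⟨hvs, hv⟩)

/-- If one removal leaves all colors but `l`, the removed element shares its color with exactly
one other element, whose removal is the only other one with this effect. -/
theorem even_card_image_erase_eq [Fintype ι] (hcard : #T = Fintype.card ι)
    (hT : T.image c ≠ univ) (l : ι) :
    Even #{s ∈ T | (T.erase s).image c = univ.erase l} := by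
  obtain h0 | ⟨s, hs⟩ := eq_empty_or_nonempty {s ∈ T | (T.erase s).image c = univ.erase l}
  · simp only [h0, card_empty, Even.zero]
  obtain ⟨hsT, hs⟩ := mem_filter.1 hs
  have hcs : c s ≠ l := fun h => hT <| by
    rw [← insert_erase hsT, image_insert, hs, h, insert_erase (mem_univ l)]
  obtain ⟨t, ht, htc⟩ := mem_image.1 (hs ▸ mem_erase.2 ⟨hcs, mem_univ _⟩)
  obtain ⟨hts, htT⟩ := mem_erase.1 ht
  have hinj : ∀ w ∈ T, (T.erase w).image c = univ.erase l → Set.InjOn c (T.erase w) := by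
    intro w hw h
    rw [← card_image_iff, h, card_erase_of_mem (mem_univ l), card_erase_of_mem hw, hcard, card_univ]
  have hpair : {s ∈ T | (T.erase s).image c = univ.erase l} = ({s, t} : Finset V) := by
    ext w
    simp only [mem_filter, mem_insert, mem_singleton]
    constructor
    · rintro ⟨hw, h⟩
      by_contra! hne
      exact hts (hinj w hw h (mem_erase.2 ⟨hne.2.symm, htT⟩) (mem_erase.2 ⟨hne.1.symm, hsT⟩) htc)
    · rintro (rfl | rfl)
      · exact ⟨hsT, hs⟩
      · refine ⟨htT, ?_⟩
        rw [image_erase_eq_image hsT hts.symm htc.symm, ← image_erase_eq_image htT hts htc, hs]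
  rw [hpair, card_pair hts.symm]
  exact even_two

end Color

section Slack

variable {ι V α : Type*} [LinearOrder α] {u : ι → V → α} {e : ι → V}

/-- Slack elements `e i`: the element `e i` comes last in the ranking `i`, while the other ones
come before all the non-slack elements there. -/
structure IsSlack (u : ι → V → α) (e : ι → V) : Prop where
  lt_of_ne : ∀ i v, v ≠ e i → u i (e i) < u i v
  lt_slack : ∀ i j v, j ≠ i → v ∉ Set.range e → u i v < u i (e j)

variable [Fintype ι] [Fintype V] [DecidableEq ι] [DecidableEq V]

theorem IsSlack.mem_extensions_iff (he : IsSlack u e) (hV : ∃ v, v ∉ Set.range e) {l : ι} {z : V} :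
    z ∈ extensions u ((univ.erase l).image e) ↔
      z ∉ Set.range e ∧ ∀ y ∉ Set.range e, u l y ≤ u l z := by
  rw [mem_extensions]
  constructor
  · rintro ⟨hz, hdom⟩
    have hmax : ∀ y ∉ Set.range e, u l y ≤ u l z := by
      intro y hy
      obtain ⟨i, hi⟩ := hdom y
      obtain rfl : i = l := by
        by_contra hil
        exact (he.lt_of_ne i y fun h => hy ⟨i, h.symm⟩).not_ge
          (hi _ (mem_insert_of_mem (mem_image_of_mem e (mem_erase.2 ⟨hil, mem_univ i⟩))))
      exact hi z (mem_insert_self _ _)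
    refine ⟨?_, hmax⟩
    rintro ⟨k, rfl⟩
    obtain rfl : k = l := by
      by_contra hkl
      exact hz (mem_image_of_mem e (mem_erase.2 ⟨hkl, mem_univ k⟩))
    obtain ⟨v, hv⟩ := hV
    exact (he.lt_of_ne k v fun h => hv ⟨k, h.symm⟩).not_ge (hmax v hv)
  · rintro ⟨hz, hmax⟩
    refine ⟨fun h => ?_, fun y => ?_⟩
    · obtain ⟨k, -, rfl⟩ := mem_image.1 h
      exact hz ⟨k, rfl⟩
    by_cases hy : y ∈ Set.range e
    · obtain ⟨i, rfl⟩ := hy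
      exact ⟨i, fun w _ => (eq_or_ne w (e i)).elim (fun h => h ▸ le_rfl)
        fun h => (he.lt_of_ne i w h).le⟩
    · refine ⟨l, (forall_mem_insert _ _ _).2 ⟨hmax y hy, forall_mem_image.2 fun k hk => ?_⟩⟩
      exact (he.lt_slack l k y (ne_of_mem_erase hk) hy).le

theorem IsSlack.card_extensions (hu : ∀ i, Function.Injective (u i)) (he : IsSlack u e)
    (hV : ∃ v, v ∉ Set.range e) (l : ι) : #(extensions u ((univ.erase l).image e)) = 1 := by
  obtain ⟨x, hx, hmax⟩ := Set.exists_max_image _ (u l) (Set.toFinite (Set.range e)ᶜ) hV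
  refine card_eq_one.2 ⟨x, ext fun z => ?_⟩
  rw [he.mem_extensions_iff hV, mem_singleton]
  constructor
  · rintro ⟨hz, hzmax⟩
    exact hu l ((hmax z hz).antisymm (hzmax x hx))
  · rintro rfl
    exact ⟨hx, hmax⟩

end Slack

section Parity

variable {ι V α : Type*} [LinearOrder α] [Fintype ι] [Fintype V] {u : ι → V → α} {c : V → ι}
  {l : ι} {S : Finset V}

open Classical in
/-- The dominant sets of full size: the rooms of the path-following argument. -/
noncomputable def rooms (u : ι → V → α) : Finset (Finset V) :=
  {T | IsDominant u T ∧ #T = Fintype.card ι}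

open Classical in
/-- The dominant sets that carry every color but `l` exactly once: the doors of the path-following
argument. A door leads into the rooms that contain it. -/
noncomputable def doors (u : ι → V → α) (c : V → ι) (l : ι) : Finset (Finset V) :=
  {S | IsDominant u S ∧ #S + 1 = Fintype.card ι ∧ S.image c = univ.erase l}

theorem mem_rooms : S ∈ rooms u ↔ IsDominant u S ∧ #S = Fintype.card ι := by simp [rooms]

variable [DecidableEq ι]

theorem mem_doors :
    S ∈ doors u c l ↔ IsDominant u S ∧ #S + 1 = Fintype.card ι ∧ S.image c = univ.erase l := by
  simp only [doors, mem_filter, mem_univ, true_and]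
  congr!

variable [DecidableEq V]

/-- Both sides count the pairs of a door and a room it leads into. -/
theorem sum_card_extensions_doors :
    ∑ S ∈ doors u c l, #(extensions u S) =
      ∑ T ∈ rooms u, #{s ∈ T | (T.erase s).image c = univ.erase l} := by
  rw [← card_sigma, ← card_sigma]
  refine card_nbij' (fun p => ⟨insert p.2 p.1, p.2⟩) (fun p => ⟨p.1.erase p.2, p.2⟩) ?_ ?_ ?_ ?_
  · rintro ⟨S, x⟩ h
    simp only [coe_sigma, Set.mem_sigma_iff, mem_coe, mem_doors, mem_extensions] at h
    obtain ⟨⟨-, hcard, hc⟩, hx, hdom⟩ := h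
    simp only [coe_sigma, Set.mem_sigma_iff, mem_coe, mem_rooms, mem_filter, erase_insert hx,
      card_insert_of_notMem hx]
    exact ⟨⟨hdom, hcard⟩, mem_insert_self _ _, hc⟩
  · rintro ⟨T, s⟩ h
    simp only [coe_sigma, Set.mem_sigma_iff, mem_coe, mem_rooms, mem_filter] at h
    obtain ⟨⟨hdom, hcard⟩, hs, hc⟩ := h
    simp only [coe_sigma, Set.mem_sigma_iff, mem_coe, mem_doors, mem_extensions, insert_erase hs,
      card_erase_add_one hs]
    exact ⟨⟨hdom.mono (erase_subset _ _), hcard, hc⟩, notMem_erase _ _, hdom⟩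
  · rintro ⟨S, x⟩ h
    simp only [coe_sigma, Set.mem_sigma_iff, mem_coe, mem_extensions] at h
    simp only [erase_insert h.2.1]
  · rintro ⟨T, s⟩ h
    simp only [coe_sigma, Set.mem_sigma_iff, mem_coe, mem_filter] at h
    simp only [insert_erase h.2.1]

theorem IsSlack.mem_doors {e : ι → V} (hu : ∀ i, Function.Injective (u i)) (he : IsSlack u e)
    (hV : ∃ v, v ∉ Set.range e) (hc : ∀ i, c (e i) = i) (l : ι) :
    (univ.erase l).image e ∈ doors u c l := by
  obtain ⟨x, hx⟩ := card_pos.1 (he.card_extensions hu hV l ▸ one_pos)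
  have hinj : Function.Injective e := Function.LeftInverse.injective hc
  refine Scarf.mem_doors.2 ⟨(mem_extensions.1 hx).2.mono (subset_insert _ _), ?_, ?_⟩
  · rw [card_image_of_injective _ hinj, card_erase_add_one (mem_univ l), card_univ]
  · rw [image_image, show c ∘ e = id from funext hc, image_id]

theorem IsSlack.card_extensions_of_ne {e : ι → V} (hu : ∀ i, Function.Injective (u i))
    (he : IsSlack u e) (hc : ∀ i, c (e i) = i) (hS : S ∈ doors u c l)
    (hne : S ≠ (univ.erase l).image e) : #(extensions u S) = 2 := by
  obtain ⟨hdom, hcard, himage⟩ := Scarf.mem_doors.1 hS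
  have hinj : Function.Injective e := Function.LeftInverse.injective hc
  obtain ⟨v, hvS, hv⟩ : ∃ v ∈ S, v ∉ Set.range e := by
    by_contra! h
    refine hne (eq_of_subset_of_card_le (fun v hv => ?_) ?_)
    · obtain ⟨k, rfl⟩ := h v hv
      exact mem_image_of_mem e (himage ▸ mem_image.2 ⟨e k, hv, hc k⟩)
    · rw [card_image_of_injective _ hinj, ← himage]
      exact card_image_le
  exact hdom.card_extensions hu ⟨v, hvS⟩ hcard fun k =>
    ⟨e k, fun j hj => ⟨v, hvS, he.lt_slack j k v hj.symm hv⟩⟩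

end Parity

/-- If no room carried all the colors, every room would have an even number of doors, whereas of
all the doors only the slack one leads into an odd number of rooms. -/
theorem IsSlack.exists_colorful {ι V α : Type*} [LinearOrder α] [Fintype ι] [DecidableEq ι]
    [Nonempty ι] [Finite V] {u : ι → V → α}
    (hu : ∀ i, Function.Injective (u i)) {e : ι → V} (he : IsSlack u e)
    (hV : ∃ v, v ∉ Set.range e) {c : V → ι} (hc : ∀ i, c (e i) = i) :
    ∃ T : Finset V, IsDominant u T ∧ T.image c = univ := by
  classical
  have := Fintype.ofFinite V
  by_contra! hno
  obtain ⟨l⟩ : Nonempty ι := inferInstance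
  have heven : Even (∑ S ∈ doors u c l, #(extensions u S)) := by
    rw [sum_card_extensions_doors]
    refine even_sum _ fun T hT => ?_
    obtain ⟨hdom, hcard⟩ := mem_rooms.1 hT
    exact even_card_image_erase_eq hcard (hno T hdom) l
  rw [← add_sum_erase _ _ (he.mem_doors hu hV hc l), he.card_extensions hu hV l] at heven
  refine Nat.not_even_one ((Nat.even_add.1 heven).2 (even_sum _ fun S hS => ?_))
  rw [he.card_extensions_of_ne hu hc (mem_of_mem_erase hS) (ne_of_mem_erase hS)]
  exact even_two

section SlackRanking

variable {ι V α : Type*} [Fintype ι] [Fintype V] [DecidableEq ι]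

/-- The rankings of `V ⊕ ι` that turn `ι` into slack elements for the rankings `u` of `V`, with
ties broken by an enumeration. -/
noncomputable def slackRanking (u : ι → V → α) (i : ι) (x : V ⊕ ι) :
    WithBot (WithTop α) ×ₗ Fin (Fintype.card (V ⊕ ι)) :=
  toLex (x.elim (fun v => ↑(u i v : WithTop α)) (fun j => if j = i then ⊥ else ⊤),
    Fintype.equivFin _ x)

theorem slackRanking_injective (u : ι → V → α) (i : ι) : Function.Injective (slackRanking u i) :=
  fun _ _ h => (Fintype.equivFin _).injective (congrArg (fun p => (ofLex p).2) h)

variable [LinearOrder α]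

theorem isSlack_slackRanking (u : ι → V → α) : IsSlack (slackRanking u) Sum.inr where
  lt_of_ne i v hv := by
    refine Prod.Lex.left _ _ ?_
    rcases v with v | j
    · simp
    · have hji : j ≠ i := fun h => hv (h ▸ rfl)
      simp [hji]
  lt_slack i j v hji hv := by
    refine Prod.Lex.left _ _ ?_
    rcases v with v | k
    · simpa [hji] using WithBot.coe_lt_coe.2 (WithTop.coe_lt_top (u i v))
    · exact absurd ⟨k, rfl⟩ hv

theorem le_of_slackRanking_inl_le {u : ι → V → α} {i : ι} {x y : V}
    (h : slackRanking u i (.inl y) ≤ slackRanking u i (.inl x)) : u i y ≤ u i x := by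
  have := Prod.Lex.monotone_fst _ _ h
  simpa [slackRanking] using this

end SlackRanking

/-- **Scarf's lemma**, for rankings with ties and without slack elements: some `S` is dominant
already with respect to the rankings whose indices appear as colors on it. -/
theorem exists_finset_forall_exists_mem_image {ι V α : Type*} [LinearOrder α] [Finite ι]
    [Finite V] [Nonempty V] (u : ι → V → α) (c : V → ι) :
    ∃ S : Finset V, ∀ y, ∃ i ∈ c '' S, ∀ x ∈ S, u i y ≤ u i x := by
  classical
  have := Fintype.ofFinite ι
  have := Fintype.ofFinite V
  have : Nonempty ι := .map c inferInstance
  obtain ⟨v⟩ : Nonempty V := inferInstance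
  obtain ⟨T, hdom, himage⟩ := (isSlack_slackRanking u).exists_colorful
    (slackRanking_injective u) (c := Sum.elim c id) ⟨.inl v, by simp⟩ fun _ => rfl
  refine ⟨T.toLeft, fun y => ?_⟩
  obtain ⟨i, hi⟩ := hdom (.inl y)
  have hiT : .inr i ∉ T := fun h =>
    (hi _ h).not_gt ((isSlack_slackRanking u).lt_of_ne i _ Sum.inl_ne_inr)
  obtain ⟨x | j, hx, hxi⟩ := mem_image.1 (himage.symm ▸ mem_univ i)
  · exact ⟨i, ⟨x, by simpa using hx, hxi⟩, fun z hz =>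
      le_of_slackRanking_inl_le (hi _ (mem_toLeft.1 hz))⟩
  · exact absurd (hxi ▸ hx) hiT

end Scarf

/-! ### The Knaster-Kuratowski-Mazurkiewicz lemma -/

section KKM

variable {ι : Type*} [Fintype ι]

theorem continuous_stdSimplex_apply (i : ι) : Continuous fun w : stdSimplex ℝ ι => w i :=
  (continuous_apply i).comp continuous_subtype_val

theorem exists_stdSimplex_add_lt [Nonempty ι] {a : ι → ℝ} (ha : ∀ i, 0 ≤ a i) {η : ℝ}
    (hη : 0 ≤ η) (hlt : ∑ i, a i + Fintype.card ι * η < 1) :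
    ∃ y : stdSimplex ℝ ι, ∀ i, a i + η < y i := by
  have hcard : (0 : ℝ) < Fintype.card ι := by exact_mod_cast Fintype.card_pos
  have hη' : η < (1 - ∑ j, a j) / Fintype.card ι := (lt_div_iff₀' hcard).2 (by linarith)
  refine ⟨⟨fun i => a i + (1 - ∑ j, a j) / Fintype.card ι, fun i => ?_, ?_⟩, fun i => ?_⟩
  · linarith [ha i]
  · rw [Finset.sum_add_distrib, Finset.sum_const, Finset.card_univ, nsmul_eq_mul,
      mul_div_cancel₀ _ hcard.ne', add_sub_cancel]
  · exact add_lt_add_right hη' _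

theorem stdSimplex_apply_le_add {a : ι → ℝ} {δ : ℝ} (ha : 1 ≤ ∑ i, a i + δ) {x : stdSimplex ℝ ι}
    (hx : ∀ i, a i ≤ x i) (i : ι) : x i ≤ a i + δ := by
  have hle : x i - a i ≤ ∑ j, (x j - a j) :=
    Finset.single_le_sum (f := fun j => x j - a j) (fun j _ => sub_nonneg.2 (hx j))
      (Finset.mem_univ i)
  rw [Finset.sum_sub_distrib, stdSimplex.sum_eq_one] at hle
  linarith

theorem stdSimplex_dist_le {a : ι → ℝ} {δ : ℝ} (hδ : 0 ≤ δ) (ha : 1 ≤ ∑ i, a i + δ)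
    {x y : stdSimplex ℝ ι} (hx : ∀ i, a i ≤ x i) (hy : ∀ i, a i ≤ y i) : dist x y ≤ δ := by
  refine (dist_pi_le_iff hδ).2 fun i => abs_sub_le_iff.2 ⟨?_, ?_⟩
  · exact sub_le_iff_le_add'.2 ((stdSimplex_apply_le_add ha hx i).trans (by gcongr; exact hy i))
  · exact sub_le_iff_le_add'.2 ((stdSimplex_apply_le_add ha hy i).trans (by gcongr; exact hx i))

theorem exists_finset_stdSimplex_dominant [Nonempty ι] (c : stdSimplex ℝ ι → ι) {η : ℝ}
    (hη : 0 < η) :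
    ∃ S : Finset (stdSimplex ℝ ι), ∀ y : stdSimplex ℝ ι,
      ∃ i ∈ c '' S, ∀ x ∈ S, y i ≤ x i + η := by
  classical
  obtain ⟨N, -, hNfin, hN⟩ := (isCompact_univ (X := stdSimplex ℝ ι)).finite_cover_balls hη
  have hnet : ∀ y : stdSimplex ℝ ι, ∃ x : N, dist y x < η := fun y => by
    obtain ⟨x, hx, hyx⟩ := Set.mem_iUnion₂.1 (hN (Set.mem_univ y))
    exact ⟨⟨x, hx⟩, hyx⟩
  have : Finite N := hNfin
  have : Nonempty N := (hnet (Classical.arbitrary _)).nonempty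
  obtain ⟨S, hS⟩ := Scarf.exists_finset_forall_exists_mem_image
    (fun i (x : N) => x.1 i) fun x => c x
  refine ⟨S.map (.subtype _), fun y => ?_⟩
  obtain ⟨x, hyx⟩ := hnet y
  obtain ⟨-, ⟨v, hv, rfl⟩, hle⟩ := hS x
  refine ⟨c v, ⟨v, by simpa using hv, rfl⟩, Finset.forall_mem_map.2 fun w hw => ?_⟩
  have hdist : y (c v) - x.1 (c v) ≤ dist y x.1 :=
    (le_abs_self _).trans (dist_le_pi_dist (y : ι → ℝ) x.1 (c v))
  change _ ≤ w.1 (c v) + η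
  linarith [hle w hw]

/-- The minimal coordinates of a dominant set sum up to almost `1`, so the set has small
diameter. -/
theorem exists_forall_lt_exists_color_eq [Nonempty ι] (c : stdSimplex ℝ ι → ι) {δ : ℝ}
    (hδ : 0 < δ) :
    ∃ z : stdSimplex ℝ ι, ∀ i, δ < z i → ∃ x, c x = i ∧ dist z x ≤ δ := by
  classical
  have hcard : (0 : ℝ) < Fintype.card ι := by exact_mod_cast Fintype.card_pos
  obtain ⟨S, hS⟩ := exists_finset_stdSimplex_dominant c (div_pos hδ hcard)
  obtain ⟨-, ⟨z, hz, -⟩, -⟩ := hS (Classical.arbitrary _)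
  obtain ⟨m, hm⟩ := Scarf.exists_isLowest (fun i (x : stdSimplex ℝ ι) => x i) ⟨z, hz⟩
  let a : ι → ℝ := fun i => if i ∈ c '' S then m i i else 0
  have ha0 : ∀ i, 0 ≤ a i := fun i => by
    dsimp only [a]; split_ifs
    exacts [stdSimplex.zero_le _ _, le_rfl]
  have ha : ∀ x ∈ S, ∀ i, a i ≤ x i := fun x hx i => by
    dsimp only [a]; split_ifs
    exacts [hm.le i x hx, stdSimplex.zero_le _ _]
  have hsum : 1 ≤ ∑ i, a i + δ := by
    by_contra! hlt
    obtain ⟨y, hy⟩ := exists_stdSimplex_add_lt ha0 (div_pos hδ hcard).le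
      (by rwa [mul_div_cancel₀ _ hcard.ne'])
    obtain ⟨i, hi, hle⟩ := hS y
    have hai : a i = m i i := if_pos hi
    exact (hy i).not_ge (hai ▸ hle (m i) (hm.mem i))
  refine ⟨z, fun i hi => ?_⟩
  have hai : a i ≠ 0 := fun h => by linarith [stdSimplex_apply_le_add hsum (ha z hz) i]
  obtain ⟨x, hx, hxi⟩ := (ite_ne_right_iff.1 hai).1
  exact ⟨x, hxi, stdSimplex_dist_le hδ.le hsum (ha z hz) (ha x hx)⟩

theorem exists_forall_pos_mem_of_isClosed [Nonempty ι] {F : ι → Set (stdSimplex ℝ ι)}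
    (hF : ∀ i, IsClosed (F i)) (hcover : ∀ z, ∃ i, z ∈ F i) :
    ∃ z : stdSimplex ℝ ι, ∀ i, 0 < z i → z ∈ F i := by
  choose c hc using hcover
  let δ : ℕ → ℝ := fun n => 1 / (n + 1)
  have hδ : ∀ n, 0 < δ n := fun n => Nat.one_div_pos_of_nat
  let K : ℕ → Set (stdSimplex ℝ ι) := fun n =>
    {z | ∀ i, z i ≤ δ n ∨ z ∈ Metric.cthickening (δ n) (F i)}
  have hK : ∀ n, IsClosed (K n) := fun n => by
    simp only [K, Set.ofPred_forall, Set.ofPred_or]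
    exact isClosed_iInter fun i =>
      (isClosed_le (continuous_stdSimplex_apply i) continuous_const).union
        Metric.isClosed_cthickening
  have hanti : ∀ n, K (n + 1) ⊆ K n := fun n z hz i =>
    have hle : δ (n + 1) ≤ δ n := Nat.one_div_le_one_div n.le_succ
    (hz i).imp (fun h => h.trans hle) fun h => Metric.cthickening_mono hle _ h
  have hne : ∀ n, (K n).Nonempty := fun n => by
    obtain ⟨z, hz⟩ := exists_forall_lt_exists_color_eq c (hδ n)
    refine ⟨z, fun i => or_iff_not_imp_left.2 fun hi => ?_⟩
    obtain ⟨x, rfl, hx⟩ := hz i (not_le.1 hi)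
    exact Metric.mem_cthickening_of_dist_le z x _ _ (hc x) hx
  obtain ⟨z, hz⟩ := IsCompact.nonempty_iInter_of_sequence_nonempty_isCompact_isClosed K hanti hne
    (hK 0).isCompact hK
  refine ⟨z, fun i hi => ?_⟩
  rw [← (hF i).closure_eq, Metric.closure_eq_iInter_cthickening]
  refine Set.mem_iInter₂.2 fun ε hε => ?_
  obtain ⟨n, hn⟩ := exists_nat_one_div_lt (lt_min hε hi)
  exact Metric.cthickening_mono (hn.le.trans (min_le_left _ _)) _
    ((Set.mem_iInter.1 hz n i).resolve_left (hn.trans_le (min_le_right _ _)).not_ge)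

/-- The **Knaster-Kuratowski-Mazurkiewicz lemma**. -/
theorem nonempty_iInter_of_forall_exists_pos_mem [Nonempty ι] {G : ι → Set (stdSimplex ℝ ι)}
    (hG : ∀ i, IsClosed (G i)) (hKKM : ∀ z : stdSimplex ℝ ι, ∃ i, 0 < z i ∧ z ∈ G i) :
    (⋂ i, G i).Nonempty := by
  classical
  have hne : ∀ i, (G i).Nonempty := fun i => by
    obtain ⟨j, hpos, hj⟩ := hKKM (stdSimplex.vertex i)
    obtain rfl : j = i := by
      by_contra h
      simp [h] at hpos
    exact ⟨_, hj⟩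
  obtain ⟨z, hz⟩ := exists_forall_pos_mem_of_isClosed
    (F := fun i => {w | ∀ j, Metric.infDist w (G j) ≤ Metric.infDist w (G i)})
    (fun i => by
      simp only [Set.ofPred_forall]
      exact isClosed_iInter fun j =>
        isClosed_le (Metric.continuous_infDist_pt _) (Metric.continuous_infDist_pt _))
    fun w => Finite.exists_max fun i => Metric.infDist w (G i)
  obtain ⟨i, hpos, hi⟩ := hKKM z
  refine ⟨z, Set.mem_iInter.2 fun j => ((hG j).mem_iff_infDist_zero (hne j)).2 ?_⟩
  exact le_antisymm ((hz i hpos j).trans_eq (Metric.infDist_zero_of_mem hi)) Metric.infDist_nonneg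

end KKM

/-! ### Equilibria of concave games -/

section KyFan

variable {E F : Type*} [AddCommGroup E] [Module ℝ E] [TopologicalSpace E] [ContinuousAdd E]
  [ContinuousSMul ℝ E] [AddCommGroup F] [Module ℝ F] [TopologicalSpace F] [ContinuousAdd F]
  [ContinuousSMul ℝ F]

/-- If no mixture `x` of the points of `s` worked, then `f x y` would be positive for all `y` in the
support of `x`, and thus for `y = x`. -/
theorem exists_forall_finset_le_zero {K : Set E} (hK : Convex ℝ K) {f : K → E → ℝ}
    (hlsc : ∀ y ∈ K, LowerSemicontinuous fun x => f x y)
    (hqc : ∀ x, QuasiconcaveOn ℝ K (f x)) (hdiag : ∀ x, f x x ≤ 0)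
    {s : Finset K} (hs : s.Nonempty) : ∃ x, ∀ y ∈ s, f x y ≤ 0 := by
  have : Nonempty s := hs.to_subtype
  let φ : stdSimplex ℝ s → K := fun w =>
    ⟨∑ y, w y • (y : E), hK.sum_mem (fun y _ => stdSimplex.zero_le w y)
      (stdSimplex.sum_eq_one w) fun y _ => y.1.2⟩
  have hφ : Continuous φ := .subtype_mk (continuous_finsetSum _ fun y _ =>
    (continuous_stdSimplex_apply y).smul continuous_const) _
  obtain ⟨w, hw⟩ := nonempty_iInter_of_forall_exists_pos_mem (ι := s)
    (G := fun y => {w | f (φ w) y ≤ 0})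
    (fun y => ((hlsc y y.1.2).isClosed_preimage 0).preimage hφ) fun w => by
      by_contra! h
      have hmem := ((hqc (φ w)).convex_gt 0).finsum_mem (ι := s) (w := w)
        (z := fun y => ((y : K) : E)) (fun y => stdSimplex.zero_le w y)
        ((finsum_eq_sum_of_fintype _).trans (stdSimplex.sum_eq_one w))
        fun y hy => ⟨y.1.2, not_le.1 (h y ((stdSimplex.zero_le w y).lt_of_ne' hy))⟩
      rw [finsum_eq_sum_of_fintype] at hmem
      exact (hdiag (φ w)).not_gt hmem.2
  exact ⟨φ w, fun y hy => Set.mem_iInter.1 hw ⟨y, hy⟩⟩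

/-- **Ky Fan's inequality**. -/
theorem exists_forall_mem_le_zero {K : Set E} (hK : IsCompact K) (hKconv : Convex ℝ K)
    (hKne : K.Nonempty) {f : K → E → ℝ} (hlsc : ∀ y ∈ K, LowerSemicontinuous fun x => f x y)
    (hqc : ∀ x, QuasiconcaveOn ℝ K (f x)) (hdiag : ∀ x, f x x ≤ 0) :
    ∃ x, ∀ y ∈ K, f x y ≤ 0 := by
  have : CompactSpace K := isCompact_iff_compactSpace.1 hK
  have : Nonempty K := hKne.to_subtype
  obtain ⟨x, hx⟩ := CompactSpace.iInter_nonempty (t := fun y : K => {x | f x y ≤ 0})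
    (fun y => (hlsc y y.2).isClosed_preimage 0) fun s => by
      obtain rfl | hs := s.eq_empty_or_nonempty
      · simp
      obtain ⟨x, hx⟩ := exists_forall_finset_le_zero hKconv hlsc hqc hdiag hs
      exact ⟨x, Set.mem_iInter₂.2 hx⟩
  exact ⟨x, fun y hy => Set.mem_iInter.1 hx ⟨y, hy⟩⟩

/-- **Nash's theorem** for two players with concave payoffs: Ky Fan's inequality for the sum of the
gains from unilateral deviations. -/
theorem exists_nash_equilibrium {C : Set E} {D : Set F} (hC : IsCompact C) (hCconv : Convex ℝ C)
    (hCne : C.Nonempty) (hD : IsCompact D) (hDconv : Convex ℝ D) (hDne : D.Nonempty)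
    {u : E → D → ℝ} {v : C → F → ℝ} (hu : Continuous fun p : C × D => u p.1 p.2)
    (hv : Continuous fun p : C × D => v p.1 p.2) (huconc : ∀ y, ConcaveOn ℝ C fun x => u x y)
    (hvconc : ∀ x, ConcaveOn ℝ D (v x)) :
    ∃ (x : C) (y : D), (∀ x' : C, u x' y ≤ u x y) ∧ ∀ y' : D, v x y' ≤ v x y := by
  let fst (p : C ×ˢ D) : C := ⟨p.1.1, p.2.1⟩
  let snd (p : C ×ˢ D) : D := ⟨p.1.2, p.2.2⟩
  have hfst : Continuous fst := by fun_prop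
  have hsnd : Continuous snd := by fun_prop
  let f (p : C ×ˢ D) (q : E × F) : ℝ :=
    u q.1 (snd p) + v (fst p) q.2 - (u (fst p) (snd p) + v (fst p) (snd p))
  have hlsc : ∀ q ∈ C ×ˢ D, LowerSemicontinuous fun p => f p q := fun q hq => by
    have hu₁ := hu.comp ((continuous_const (y := ⟨q.1, hq.1⟩)).prodMk hsnd)
    have hv₁ := hv.comp (hfst.prodMk (continuous_const (y := ⟨q.2, hq.2⟩)))
    exact ((hu₁.add hv₁).sub ((hu.add hv).comp (hfst.prodMk hsnd))).lowerSemicontinuous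
  have hqc : ∀ p, QuasiconcaveOn ℝ (C ×ˢ D) (f p) := fun p => by
    have hprod := hCconv.prod hDconv
    have hu₁ := ((huconc (snd p)).comp_linearMap (.fst ℝ E F)).subset (fun _ h => h.1) hprod
    have hv₁ := ((hvconc (fst p)).comp_linearMap (.snd ℝ E F)).subset (fun _ h => h.2) hprod
    exact ((hu₁.add hv₁).sub (convexOn_const _ hprod)).quasiconcaveOn
  obtain ⟨p, hp⟩ := exists_forall_mem_le_zero (hC.prod hD) (hCconv.prod hDconv)
    (hCne.prod hDne) hlsc hqc fun p => (sub_self _).le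
  refine ⟨fst p, snd p, fun x' => ?_, fun y' => ?_⟩
  · simpa [f] using hp (x', snd p) ⟨x'.2, p.2.2⟩
  · simpa [f] using hp (fst p, y') ⟨p.2.1, y'.2⟩

end KyFan

namespace BerkNash

/-! ### Continuity of the discounted value -/

section Value

variable {X A : Type*}

instance [Finite X] [Finite A] : Finite (StateAction X A) :=
  Finite.of_injective (fun s => (s.state, s.action)) fun ⟨_, _⟩ ⟨_, _⟩ h => by simpa using h

theorem exists_forall_abs_le [Finite X] [Finite A] (r : X → A → ℝ) : ∃ C, ∀ x a, |r x a| ≤ C := by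
  obtain ⟨C, hC⟩ := (Set.finite_range fun p : X × A => |r p.1 p.2|).bddAbove
  exact ⟨C, fun x a => hC ⟨(x, a), rfl⟩⟩

theorem integral_sum_smul_dirac {ι Ω G : Type*} [Fintype ι] [MeasurableSpace Ω]
    [MeasurableSingletonClass Ω] [NormedAddCommGroup G] [NormedSpace ℝ G] [CompleteSpace G]
    {w : ι → ℝ} (hw : ∀ i, 0 ≤ w i) (f : ι → Ω) (g : Ω → G) :
    ∫ s, g s ∂(∑ i, ENNReal.ofReal (w i) • Measure.dirac (f i)) = ∑ i, w i • g (f i) := by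
  rw [integral_finsetSum_measure fun i _ =>
    (integrable_dirac (by finiteness)).smul_measure ENNReal.ofReal_ne_top]
  refine Finset.sum_congr rfl fun i _ => ?_
  rw [integral_smul_measure, integral_dirac, ENNReal.toReal_ofReal (hw i)]

theorem continuous_policy_apply [Fintype A] (x : X) (a : A) :
    Continuous fun π : Policy X A => π x a :=
  (continuous_stdSimplex_apply a).comp (continuous_apply x)

theorem integral_initialMeasure [Fintype A] (π : Policy X A) (x : X) (g : StateAction X A → ℝ) :
    ∫ s, g s ∂(initialMeasure π x) = ∑ a, π x a * g ⟨x, a⟩ :=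
  integral_sum_smul_dirac (fun a => stdSimplex.zero_le (π x) a) _ g

variable [Fintype X]

theorem continuous_transitionKernel_apply (x : X) (a : A) (x' : X) :
    Continuous fun K : TransitionKernel X A => K x a x' :=
  (continuous_stdSimplex_apply x').comp (continuous_apply_apply x a)

theorem continuousOn_transitionKernel {T : Type*} [TopologicalSpace T]
    {Q : T → TransitionKernel X A} {Θ : Set T}
    (hQ : ∀ x a x', ContinuousOn (fun θ => Q θ x a x') Θ) : ContinuousOn Q Θ :=
  continuousOn_pi.2 fun x => continuousOn_pi.2 fun a =>
    Topology.IsInducing.subtypeVal.continuousOn_iff.2 (continuousOn_pi.2 (hQ x a))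

variable [Fintype A]

theorem integral_pairMeasure (π : Policy X A) (ν : stdSimplex ℝ X) (g : StateAction X A → ℝ) :
    ∫ s, g s ∂(pairMeasure π ν) = ∑ x, ∑ a, ν x * π x a * g ⟨x, a⟩ := by
  rw [pairMeasure, ← Fintype.sum_prod_type', ← Fintype.sum_prod_type']
  exact integral_sum_smul_dirac (ι := X × A)
    (fun p => mul_nonneg (stdSimplex.zero_le ν p.1) (stdSimplex.zero_le (π p.1) p.2)) _ g

instance (K : TransitionKernel X A) (π : Policy X A) (x : X) :
    IsProbabilityMeasure (processLaw K π x) := by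
  rw [processLaw]
  infer_instance

theorem integrable_comp_eval (K : TransitionKernel X A) (π : Policy X A) (x : X) (t : ℕ)
    (g : StateAction X A → ℝ) : Integrable (fun ω => g (ω t)) (processLaw K π x) := by
  have : IsProbabilityMeasure ((processLaw K π x).map fun ω => ω t) :=
    Measure.isProbabilityMeasure_map (measurable_pi_apply t).aemeasurable
  exact (Integrable.of_finite (f := g)).comp_measurable (measurable_pi_apply t)

/-- The conditional expectation of `g (x_{t+1}, a_{t+1})` given `(x_t, a_t)`, as an operator that
can be iterated to compute the expectation of `g (x_t, a_t)`. -/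
def nextMean (K : TransitionKernel X A) (π : Policy X A) (g : StateAction X A → ℝ)
    (s : StateAction X A) : ℝ :=
  ∑ x, ∑ a, K s.state s.action x * π x a * g ⟨x, a⟩

theorem integral_stepKernel (K : TransitionKernel X A) (π : Policy X A) (t : ℕ)
    (h : Π _ : Finset.Iic t, StateAction X A) (g : StateAction X A → ℝ) :
    ∫ s, g s ∂(stepKernel K π t h) = nextMean K π g (h ⟨t, Finset.mem_Iic.2 le_rfl⟩) :=
  integral_pairMeasure _ _ g

theorem integral_map_frestrictLe (K : TransitionKernel X A) (π : Policy X A) (x : X) (t : ℕ)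
    (g : StateAction X A → ℝ) :
    ∫ h, g (h ⟨t, Finset.mem_Iic.2 le_rfl⟩)
        ∂((processLaw K π x).map (Preorder.frestrictLe (π := fun _ => StateAction X A) t)) =
      ∫ ω, g (ω t) ∂(processLaw K π x) := by
  have hg : Measurable g := .of_discrete
  let last : Finset.Iic t := ⟨t, Finset.mem_Iic.2 le_rfl⟩
  exact integral_map (by fun_prop) (hg.comp (measurable_pi_apply last)).aestronglyMeasurable

theorem integral_eval_succ (K : TransitionKernel X A) (π : Policy X A) (x : X) (t : ℕ)
    (g : StateAction X A → ℝ) :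
    ∫ ω, g (ω (t + 1)) ∂(processLaw K π x) = ∫ ω, nextMean K π g (ω t) ∂(processLaw K π x) := by
  let split (ω : ℕ → StateAction X A) :=
    (Preorder.frestrictLe (π := fun _ => StateAction X A) t ω, ω (t + 1))
  have hsplit : Measurable split := by fun_prop
  have hint : Integrable (fun p => g p.2) ((processLaw K π x).map split) :=
    (integrable_map_measure (by fun_prop) hsplit.aemeasurable).2
      (integrable_comp_eval K π x (t + 1) g)
  have hmap : (processLaw K π x).map split =
      (processLaw K π x).map (Preorder.frestrictLe t) ⊗ₘ stepKernel K π t :=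
    Kernel.map_frestrictLe_trajMeasure_compProd_eq_map_trajMeasure.symm
  calc ∫ ω, g (ω (t + 1)) ∂(processLaw K π x)
      = ∫ p, g p.2 ∂((processLaw K π x).map split) :=
        (integral_map (f := fun p => g p.2) hsplit.aemeasurable (by fun_prop)).symm
    _ = ∫ h, ∫ s, g s ∂(stepKernel K π t h)
          ∂((processLaw K π x).map (Preorder.frestrictLe t)) := by
        rw [hmap] at hint ⊢
        exact Measure.integral_compProd hint
    _ = ∫ ω, nextMean K π g (ω t) ∂(processLaw K π x) := by
        simp_rw [integral_stepKernel]
        exact integral_map_frestrictLe K π x t _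

theorem integral_eval_zero (K : TransitionKernel X A) (π : Policy X A) (x : X)
    (g : StateAction X A → ℝ) :
    ∫ ω, g (ω 0) ∂(processLaw K π x) = ∑ a, π x a * g ⟨x, a⟩ := by
  have hmap : (processLaw K π x).map (Preorder.frestrictLe 0) = (initialMeasure π x).map
      (MeasurableEquiv.piUnique fun _ : Finset.Iic 0 => StateAction X A).symm := by
    rw [processLaw, Kernel.trajMeasure, Measure.map_comp _ _ (by fun_prop),
      Kernel.traj_map_frestrictLe, Kernel.partialTraj_self, Measure.id_comp]
  rw [← integral_map_frestrictLe, hmap, integral_map_equiv, ← integral_initialMeasure]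
  rfl

theorem integral_eval (K : TransitionKernel X A) (π : Policy X A) (x : X) (t : ℕ)
    (g : StateAction X A → ℝ) :
    ∫ ω, g (ω t) ∂(processLaw K π x) = ∑ a, π x a * (nextMean K π)^[t] g ⟨x, a⟩ := by
  induction t generalizing g with
  | zero => exact integral_eval_zero K π x g
  | succ t ih => rw [integral_eval_succ, ih, Function.iterate_succ_apply]

theorem continuous_iterate_nextMean (g : StateAction X A → ℝ) (t : ℕ) (s : StateAction X A) :
    Continuous fun p : TransitionKernel X A × Policy X A => (nextMean p.1 p.2)^[t] g s := by
  induction t generalizing s with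
  | zero => exact continuous_const
  | succ t ih =>
    simp only [Function.iterate_succ_apply', nextMean]
    exact continuous_finsetSum _ fun x _ => continuous_finsetSum _ fun a _ =>
      (((continuous_transitionKernel_apply s.state s.action x).comp continuous_fst).mul
        ((continuous_policy_apply x a).comp continuous_snd)).mul (ih _)

theorem continuous_integral_eval (g : StateAction X A → ℝ) (t : ℕ) (x : X) :
    Continuous fun p : TransitionKernel X A × Policy X A =>
      ∫ ω, g (ω t) ∂(processLaw p.1 p.2 x) := by
  simp_rw [integral_eval]
  exact continuous_finsetSum _ fun a _ =>
    ((continuous_policy_apply x a).comp continuous_snd).mul (continuous_iterate_nextMean g t _)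

theorem value_eq_tsum (K : TransitionKernel X A) (r : X → A → ℝ) {β : ℝ} (hβ : |β| < 1)
    (π : Policy X A) (x : X) :
    value K r β π x =
      ∑' t, β ^ t * ∫ ω, r (ω t).state (ω t).action ∂(processLaw K π x) := by
  obtain ⟨C, hC⟩ := exists_forall_abs_le r
  have hint : ∀ t : ℕ, Integrable (fun ω => β ^ t * r (ω t).state (ω t).action)
      (processLaw K π x) := fun t =>
    (integrable_comp_eval K π x t fun s => r s.state s.action).const_mul _
  have hle : ∀ t : ℕ,
      ∫ ω, ‖β ^ t * r (ω t).state (ω t).action‖ ∂(processLaw K π x) ≤ |β| ^ t * C := fun t => by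
    refine (integral_mono (hint t).norm (integrable_const (|β| ^ t * C)) fun ω => ?_).trans_eq
      (by simp)
    simp only [norm_mul, norm_pow, Real.norm_eq_abs]
    gcongr
    exact hC _ _
  have hsummable : Summable fun t : ℕ => |β| ^ t * C :=
    (summable_geometric_of_lt_one (abs_nonneg β) hβ).mul_right C
  simp_rw [← integral_const_mul]
  exact (integral_tsum_of_summable_integral_norm hint
    (hsummable.of_nonneg_of_le (fun t => integral_nonneg fun ω => norm_nonneg _) hle)).symm

theorem continuous_value (r : X → A → ℝ) {β : ℝ} (hβ : |β| < 1) (x : X) :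
    Continuous fun p : TransitionKernel X A × Policy X A => value p.1 r β p.2 x := by
  obtain ⟨C, hC⟩ := exists_forall_abs_le r
  simp_rw [value_eq_tsum _ r hβ]
  refine continuous_tsum (fun t => continuous_const.mul
    (continuous_integral_eval (fun s => r s.state s.action) t x))
    ((summable_geometric_of_lt_one (abs_nonneg β) hβ).mul_right C) fun t p => ?_
  rw [norm_mul, norm_pow, Real.norm_eq_abs]
  gcongr
  exact (norm_integral_le_of_norm_le_const (.of_forall fun ω => hC _ _)).trans_eq (by simp)

theorem continuous_optimalValue (r : X → A → ℝ) {β : ℝ} (hβ : |β| < 1) (x : X) :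
    Continuous fun K : TransitionKernel X A => optimalValue K r β x := by
  simpa only [Set.image_univ, optimalValue, iSup] using
    (isCompact_univ (X := Policy X A)).continuous_sSup (continuous_value r hβ x)

theorem continuous_actionValue (r : X → A → ℝ) {β : ℝ} (hβ : |β| < 1) (x : X) (a : A) :
    Continuous fun K : TransitionKernel X A => actionValue K r β x a :=
  continuous_const.add <| continuous_const.mul <| continuous_finsetSum _ fun x' _ =>
    (continuous_transitionKernel_apply x a x').mul (continuous_optimalValue r hβ x')

end Value

/-! ### Equilibria between an agent and nature -/

section Equilibrium

variable {X A : Type*} [Fintype A]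

theorem le_of_forall_le_sum {q : A → ℝ} {w : stdSimplex ℝ A} (h : ∀ b, q b ≤ ∑ c, w c * q c)
    {a : A} (ha : 0 < w a) (b : A) : q b ≤ q a := by
  refine (h b).trans (not_lt.1 fun hlt => ?_)
  have hsum : ∑ c, w c * q c < ∑ c, w c * ∑ d, w d * q d :=
    Finset.sum_lt_sum (fun c _ => mul_le_mul_of_nonneg_left (h c) (stdSimplex.zero_le w c))
      ⟨a, Finset.mem_univ a, mul_lt_mul_of_pos_left hlt ha⟩
  rw [← Finset.sum_mul, stdSimplex.sum_eq_one, one_mul] at hsum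
  exact hsum.false

theorem le_of_forall_policy_sum_le [Fintype X] {q : X → A → ℝ} {π : Policy X A}
    (h : ∀ π' : Policy X A, ∑ x, ∑ a, π' x a * q x a ≤ ∑ x, ∑ a, π x a * q x a) {x : X} {a : A}
    (ha : 0 < π x a) (b : A) : q x b ≤ q x a := by
  classical
  refine le_of_forall_le_sum (fun b => ?_) ha b
  by_contra! hlt
  have hb : ∑ a, Function.update π x (stdSimplex.vertex b) x a * q x a = q x b := by
    simp [Pi.single_apply]
  refine (h (Function.update π x (stdSimplex.vertex b))).not_gt
    (Finset.sum_lt_sum (fun y _ => ?_) ⟨x, Finset.mem_univ x, hlt.trans_eq hb.symm⟩)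
  obtain rfl | hyx := eq_or_ne y x
  · exact (hlt.trans_eq hb.symm).le
  · rw [Function.update_of_ne hyx]

theorem exists_equilibrium [Finite X] [Nonempty A] {E : Type*} [AddCommGroup E] [Module ℝ E]
    [TopologicalSpace E] [ContinuousAdd E] [ContinuousSMul ℝ E] {Θ : Set E}
    (hΘ : IsCompact Θ) (hconvex : Convex ℝ Θ) (hne : Θ.Nonempty) {q : E → X → A → ℝ}
    (hq : ∀ x a, ContinuousOn (fun θ => q θ x a) Θ) {D : E → Policy X A → ℝ}
    (hD : ContinuousOn (fun p : E × Policy X A => D p.1 p.2) (Θ ×ˢ Set.univ))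
    (hDconvex : ∀ π, ConvexOn ℝ Θ fun θ => D θ π) :
    ∃ π : Policy X A, ∃ θ ∈ Θ, (∀ x a, 0 < π x a → ∀ b, q θ x b ≤ q θ x a) ∧
      ∀ θ' ∈ Θ, D θ π ≤ D θ' π := by
  have := Fintype.ofFinite X
  let C : Set (X → A → ℝ) := Set.univ.pi fun _ => stdSimplex ℝ A
  let policy (w : C) : Policy X A := fun x => ⟨w.1 x, w.2 x trivial⟩
  have hpolicy : Continuous policy :=
    continuous_pi fun x => ((continuous_apply x).comp continuous_subtype_val).subtype_mk _
  have hCconvex : Convex ℝ C := convex_pi fun _ _ => convex_stdSimplex ℝ A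
  obtain ⟨w, θ, hw, hθ⟩ := exists_nash_equilibrium
    (u := fun w (θ : Θ) => ∑ x, ∑ a, w x a * q θ x a) (v := fun w θ => -D θ (policy w))
    (isCompact_univ_pi fun _ => isCompact_stdSimplex ℝ A) hCconvex
    (Set.univ_pi_nonempty_iff.2 fun _ => ⟨_, (Classical.arbitrary (stdSimplex ℝ A)).2⟩)
    hΘ hconvex hne
    (continuous_finsetSum _ fun x _ => continuous_finsetSum _ fun a _ =>
      (((continuous_apply_apply x a).comp continuous_subtype_val).comp continuous_fst).mul
        ((continuousOn_iff_continuous_domRestrict.1 (hq x a)).comp continuous_snd))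
    (hD.comp_continuous ((continuous_subtype_val.comp continuous_snd).prodMk
      (hpolicy.comp continuous_fst)) fun p => ⟨p.2.2, trivial⟩).neg
    (fun θ => ((∑ x, ∑ a, q θ x a •
      (LinearMap.proj a ∘ₗ LinearMap.proj x : (X → A → ℝ) →ₗ[ℝ] ℝ)).concaveOn hCconvex).congr
        fun w _ => by simp [mul_comm])
    fun w => (hDconvex (policy w)).neg
  refine ⟨policy w, θ, θ.2, fun x a => le_of_forall_policy_sum_le fun π' => ?_, fun θ' hθ' => ?_⟩
  · exact hw ⟨fun x => π' x, fun x _ => (π' x).2⟩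
  · exact neg_le_neg_iff.1 (hθ ⟨θ', hθ'⟩)

end Equilibrium

end BerkNash

theorem mainTheorem1_general {X A : Type*} [Fintype X] [Fintype A] [Nonempty A] {E : Type*}
    [AddCommGroup E] [Module ℝ E] [TopologicalSpace E] [ContinuousAdd E] [ContinuousSMul ℝ E]
    (r : X → A → ℝ) {β : ℝ} (hβ : |β| < 1) {Θ : Set E} {Q : E → BerkNash.TransitionKernel X A}
    (hΘ_nonempty : Θ.Nonempty) (hΘ_compact : IsCompact Θ) (hΘ_convex : Convex ℝ Θ)
    (hQ_cont : ∀ x a x', ContinuousOn (fun θ => Q θ x a x') Θ)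
    {D : E → BerkNash.Policy X A → ℝ}
    (hD_cont : ContinuousOn (fun p : E × BerkNash.Policy X A => D p.1 p.2) (Θ ×ˢ Set.univ))
    (hD_convex : ∀ π, ConvexOn ℝ Θ fun θ => D θ π) :
    ∃ π : BerkNash.Policy X A, ∃ θ ∈ Θ,
      π ∈ BerkNash.bestResponse Q r β θ ∧ ∀ θ' ∈ Θ, D θ π ≤ D θ' π :=
  BerkNash.exists_equilibrium hΘ_compact hΘ_convex hΘ_nonempty
    (fun x a => (BerkNash.continuous_actionValue r hβ x a).comp_continuousOn
      (BerkNash.continuousOn_transitionKernel hQ_cont))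
    hD_cont hD_convex

theorem mainTheorem1 {X A : Type*} [Fintype X] [DecidableEq X] [Nonempty X]
    [Fintype A] [Nonempty A] {k : ℕ}
    -- the true kernel, the reward, the discount factor, the parameter set, the subjective kernels
    (P : BerkNash.TransitionKernel X A) (r : X → A → ℝ) (β : ℝ)
    (Θ : Set (EuclideanSpace ℝ (Fin k)))
    (Q : EuclideanSpace ℝ (Fin k) → BerkNash.TransitionKernel X A)
    -- primitives and continuity
    (hβ0 : 0 < β) (hβ1 : β < 1)
    (hΘ_nonempty : Θ.Nonempty) (hΘ_compact : IsCompact Θ) (hΘ_convex : Convex ℝ Θ)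
    (hQ_cont : ∀ x a x', ContinuousOn (fun θ => Q θ x a x') Θ)
    -- ergodicity and continuity of stationary distributions
    (h_irred : ∀ π : BerkNash.Policy X A, (BerkNash.inducedMatrix P π).IsIrreducible)
    (h_aper : ∀ π : BerkNash.Policy X A, BerkNash.IsAperiodic (BerkNash.inducedMatrix P π))
    (h_stat_cont : Continuous fun π : BerkNash.Policy X A => BerkNash.stationaryDist P π)
    -- well-behaved Kullback-Leibler functional
    (h_ac : ∀ θ ∈ Θ, ∀ x a x', Q θ x a x' = 0 → P x a x' = 0)
    (hD_cont : ContinuousOn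
      (fun p : EuclideanSpace ℝ (Fin k) × BerkNash.Policy X A => BerkNash.longRunKL P Q p.1 p.2)
      (Θ ×ˢ Set.univ))
    (hD_convex : ∀ π : BerkNash.Policy X A,
      ConvexOn ℝ Θ fun θ => BerkNash.longRunKL P Q θ π) :
    ∃ π : BerkNash.Policy X A, ∃ θ ∈ Θ, BerkNash.IsSolution P Q Θ r β π θ := by
  obtain ⟨π, θ, hθ, hπ, hD⟩ := mainTheorem1_general r (abs_lt.2 ⟨by linarith, hβ1⟩) hΘ_nonempty
    hΘ_compact hΘ_convex hQ_cont hD_cont hD_convex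
  exact ⟨π, θ, hθ, hπ, hθ, hD⟩
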